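/- Language. The arithmetical language has equality and a function symbol for each definition of a primitive recursive function: $0$, $s$, $+$, $\cdot$, the projections, and a symbol for every composition and every primitive recursion from given symbols. The logical symbols $\bot,\wedge,\vee,\supset,\forall,\exists$ are primitive and $\neg A$ is $A\supset\bot$. $\mathbf{HA}$ (Heyting arithmetic) is intuitionistic first-order logic with equality together with the axioms $\neg(s(t)=0)$ and $s(t)=s(t')\supset t=t'$, the defining equations of all the function symbols, and induction for all formulas. $\mathbf{MEA}$ (Horsten's modal-epistemic arithmetic) has in addition two primitive unary sentential operators $\Box$ and $P$, and $\Diamond A$ abbreviates $\neg\Box\neg A$. It is Peano arithmetic (classical first-order logic with equality and the same arithmetical axioms, with substitution of equals and induction for all formulas of the enlarged language) together with the axioms $\Box A\supset A$; $\ \Box A\wedge\Box(A\supset B)\supset\Box B$; $\ \Diamond A\supset\Box\Diamond A$; $\ \Diamond A\supset A$ for $A$ containing neither $\Box$ nor $P$; $\ \Diamond\exists xA\supset\exists x\Diamond A$; $\ PA\supset A$; $\ PA\supset PPA$; $\ \Diamond PA\wedge\Diamond P(A\supset B)\supset\Diamond PB$; and the rules: from $\vdash A$ infer $\vdash\Box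 A$, and from $\vdash A$ infer $\vdash\Diamond PA$. Let $f$ be a binary primitive recursive function symbol and let $R(x,y)$ be $f(x,y)=0$. Consider the rules - $\mathsf{MR}$: $\ \vdash_{\mathbf{HA}}\forall x\neg\neg\exists yR(x,y)\ \Rightarrow\ \vdash_{\mathbf{HA}}\forall x\exists yR(x,y)$; - $\mathsf{HMR_{Nt}}$: $\ \vdash_{\mathbf{MEA}}\Diamond P\forall x\neg\Diamond P\neg\exists yR(x,y)\ \Rightarrow\ \vdash_{\mathbf{MEA}}\Diamond P\forall x\exists yR(x,y)$; - $\mathsf{HMR_{W1}}$: $\ \vdash_{\mathbf{MEA}}\Diamond\forall x\Diamond P\exists yR(x,y)\ \Rightarrow\ \vdash_{\mathbf{MEA}}\Diamond P\forall x\exists yR(x,y)$; - $\mathsf{HMR_{W2}}$: $\ \vdash_{\mathbf{MEA}}\Box\forall x\neg\Diamond P\neg\exists yR(x,y)\ \Rightarrow\ \vdash_{\mathbf{MEA}}\Box\forall x\exists yR(x,y)$; - $\mathsf{HMR_{W3}}$: $\ \vdash_{\mathbf{MEA}}\Box\forall x\Diamond\exists yR(x,y)\ \Rightarrow\ \vdash_{\mathbf{MEA}}\Box\forall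 x\exists yR(x,y)$. Theorem. For every such $f$, if $\mathsf{MR}$ holds for $R$, then $\mathsf{HMR_{Nt}}$, $\mathsf{HMR_{W1}}$, $\mathsf{HMR_{W2}}$ and $\mathsf{HMR_{W3}}$ hold for $R$. In particular, $\mathsf{MR}$ (for all $f$) implies each of $\mathsf{HMR_{Nt}}$, $\mathsf{HMR_{W1}}$, $\mathsf{HMR_{W2}}$, $\mathsf{HMR_{W3}}$ (for all $f$). -/

import Mathlib

namespace ModalArith

/-! ### The arithmetical language -/

/-- Primitive recursive function symbols, by arity: `0`, `s`, `+`, `·`, the projections, and a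
symbol for every composition and every primitive recursion. -/
inductive PRFun : ℕ → Type
  | zero : PRFun 0
  | succ : PRFun 1
  | add : PRFun 2
  | mul : PRFun 2
  | proj {n : ℕ} (i : Fin n) : PRFun n
  | comp {m n : ℕ} (f : PRFun m) (g : Fin m → PRFun n) : PRFun n
  | prec {n : ℕ} (f : PRFun n) (g : PRFun (n + 2)) : PRFun (n + 1)

/-- The first-order language with a function symbol for each primitive recursive function
(equality is the only predicate and is treated as logical). -/
def Lang : FirstOrder.Language := ⟨PRFun, fun _ => Empty⟩

/-- Terms over the variables `0, 1, 2, …`, which are read as de Bruijn indices. -/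
abbrev Term : Type := Lang.Term ℕ

namespace Term

/-- The variable with index `n`. -/
def v (n : ℕ) : Term := FirstOrder.Language.Term.var n

/-- Application of a function symbol. -/
def app {n : ℕ} (f : PRFun n) (ts : Fin n → Term) : Term :=
  FirstOrder.Language.Term.func (L := Lang) f ts

def zero : Term := app PRFun.zero ![]

def succ (t : Term) : Term := app PRFun.succ ![t]

def add (s t : Term) : Term := app PRFun.add ![s, t]

def mul (s t : Term) : Term := app PRFun.mul ![s, t]

end Term

/-! ### Substitutions -/

/-- A substitution carried under one quantifier. -/
def lift (σ : ℕ → Term) : ℕ → Term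
  | 0 => Term.v 0
  | n + 1 => FirstOrder.Language.Term.relabel Nat.succ (σ n)

/-- Replace the variable `0` by `t` and lower the other variables. -/
def instSubst (t : Term) : ℕ → Term
  | 0 => t
  | n + 1 => Term.v n

/-- Replace the variable `0` by its successor and keep the other variables. -/
def succSubst : ℕ → Term
  | 0 => Term.succ (Term.v 0)
  | n + 1 => Term.v (n + 1)

/-! ### Formulas -/

/-- First-order formulas with equality, with a unary sentential operator for each `m : M`.
`all A` and `ex A` bind the variable `0` of `A`. -/
inductive Formula (M : Type) : Type
  | bot : Formula M
  | eq (s t : Term) : Formula M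
  | and (A B : Formula M) : Formula M
  | or (A B : Formula M) : Formula M
  | imp (A B : Formula M) : Formula M
  | all (A : Formula M) : Formula M
  | ex (A : Formula M) : Formula M
  | op (m : M) (A : Formula M) : Formula M

namespace Formula

variable {M : Type}

def neg (A : Formula M) : Formula M := imp A bot

/-- Simultaneous capture-avoiding substitution. -/
def subst : Formula M → (ℕ → Term) → Formula M
  | bot, _ => bot
  | eq s t, σ => eq (FirstOrder.Language.Term.subst s σ) (FirstOrder.Language.Term.subst t σ)
  | and A B, σ => and (A.subst σ) (B.subst σ)
  | or A B, σ => or (A.subst σ) (B.subst σ)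
  | imp A B, σ => imp (A.subst σ) (B.subst σ)
  | all A, σ => all (A.subst (lift σ))
  | ex A, σ => ex (A.subst (lift σ))
  | op m A, σ => op m (A.subst σ)

/-- `A` with all free variables raised by one; the variable `0` is not free in the result. -/
def shift (A : Formula M) : Formula M := A.subst fun n => Term.v (n + 1)

/-- `A[t/x]`, where `x` is the variable `0`. -/
def inst (A : Formula M) (t : Term) : Formula M := A.subst (instSubst t)

/-- `A` contains none of the operators in `M`. -/
def OpFree : Formula M → Prop
  | bot => True
  | eq _ _ => True
  | and A B => A.OpFree ∧ B.OpFree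
  | or A B => A.OpFree ∧ B.OpFree
  | imp A B => A.OpFree ∧ B.OpFree
  | all A => A.OpFree
  | ex A => A.OpFree
  | op _ _ => False

end Formula

open Formula in
/-- The arithmetical axioms: the axioms on `0` and `s`, the defining equations of `+`, `·` and of
the other primitive recursive function symbols, and induction for all formulas of the language. -/
inductive ArithAxiom (M : Type) : Formula M → Prop
  | succ_ne_zero (t : Term) : ArithAxiom M (neg (eq t.succ Term.zero))
  | succ_inj (s t : Term) : ArithAxiom M (imp (eq s.succ t.succ) (eq s t))
  | add_zero (t : Term) : ArithAxiom M (eq (t.add Term.zero) t)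
  | add_succ (s t : Term) : ArithAxiom M (eq (s.add t.succ) (s.add t).succ)
  | mul_zero (t : Term) : ArithAxiom M (eq (t.mul Term.zero) Term.zero)
  | mul_succ (s t : Term) : ArithAxiom M (eq (s.mul t.succ) ((s.mul t).add s))
  | proj {n : ℕ} (i : Fin n) (ts : Fin n → Term) :
      ArithAxiom M (eq (Term.app (PRFun.proj i) ts) (ts i))
  | comp {m n : ℕ} (f : PRFun m) (g : Fin m → PRFun n) (ts : Fin n → Term) :
      ArithAxiom M (eq (Term.app (PRFun.comp f g) ts) (Term.app f fun i => Term.app (g i) ts))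
  | prec_zero {n : ℕ} (f : PRFun n) (g : PRFun (n + 2)) (ts : Fin n → Term) :
      ArithAxiom M (eq (Term.app (PRFun.prec f g) (Fin.cons Term.zero ts)) (Term.app f ts))
  | prec_succ {n : ℕ} (f : PRFun n) (g : PRFun (n + 2)) (t : Term) (ts : Fin n → Term) :
      ArithAxiom M (eq (Term.app (PRFun.prec f g) (Fin.cons t.succ ts))
        (Term.app g (Fin.cons t (Fin.cons (Term.app (PRFun.prec f g) (Fin.cons t ts)) ts))))
  | induction (A : Formula M) :
      ArithAxiom M (imp (A.inst Term.zero) (imp (all (imp A (A.subst succSubst))) (all A)))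

/-! ### Heyting arithmetic -/

/-- Formulas of Heyting arithmetic: no sentential operators. -/
abbrev HAFormula : Type := Formula Empty

open Formula in
/-- Heyting arithmetic in natural deduction: `HA Γ A` means that `A` has a derivation whose open
assumptions are among `Γ`. -/
inductive HA : List HAFormula → HAFormula → Prop
  | assumption {Γ : List HAFormula} {A : HAFormula} : A ∈ Γ → HA Γ A
  | andI {Γ : List HAFormula} {A B : HAFormula} : HA Γ A → HA Γ B → HA Γ (and A B)
  | andE_left {Γ : List HAFormula} {A B : HAFormula} : HA Γ (and A B) → HA Γ A
  | andE_right {Γ : List HAFormula} {A B : HAFormula} : HA Γ (and A B) → HA Γ B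
  | orI_left {Γ : List HAFormula} {A B : HAFormula} : HA Γ A → HA Γ (or A B)
  | orI_right {Γ : List HAFormula} {A B : HAFormula} : HA Γ B → HA Γ (or A B)
  | orE {Γ : List HAFormula} {A B C : HAFormula} :
      HA Γ (or A B) → HA (A :: Γ) C → HA (B :: Γ) C → HA Γ C
  | impI {Γ : List HAFormula} {A B : HAFormula} : HA (A :: Γ) B → HA Γ (imp A B)
  | impE {Γ : List HAFormula} {A B : HAFormula} : HA Γ A → HA Γ (imp A B) → HA Γ B
  | botE {Γ : List HAFormula} {A : HAFormula} : HA Γ bot → HA Γ A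
  | allI {Γ : List HAFormula} {A : HAFormula} : HA (Γ.map shift) A → HA Γ (all A)
  | allE {Γ : List HAFormula} {A : HAFormula} (t : Term) : HA Γ (all A) → HA Γ (A.inst t)
  | exI {Γ : List HAFormula} {A : HAFormula} (t : Term) : HA Γ (A.inst t) → HA Γ (ex A)
  | exE {Γ : List HAFormula} {A B : HAFormula} :
      HA Γ (ex A) → HA (A :: Γ.map shift) B.shift → HA Γ B
  | eq_refl {Γ : List HAFormula} (t : Term) : HA Γ (eq t t)
  | eq_sub {Γ : List HAFormula} {s t : Term} (A : HAFormula) :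
      HA Γ (eq s t) → HA Γ (A.inst s) → HA Γ (A.inst t)
  | arith {Γ : List HAFormula} {A : HAFormula} : ArithAxiom Empty A → HA Γ A

/-! ### Modal-epistemic arithmetic -/

/-- The two primitive operators of modal-epistemic arithmetic: necessity and "it is proved". -/
inductive Modality : Type
  | box : Modality
  | prf : Modality

/-- Formulas of modal-epistemic arithmetic. -/
abbrev MEAFormula : Type := Formula Modality

/-- `□ A` -/
def box (A : MEAFormula) : MEAFormula := Formula.op Modality.box A

/-- `P A` -/
def prf (A : MEAFormula) : MEAFormula := Formula.op Modality.prf A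

/-- `◇ A`, that is, `¬ □ ¬ A` -/
def dia (A : MEAFormula) : MEAFormula := (box A.neg).neg

open Formula in
/-- Theorems of modal-epistemic arithmetic, in a Hilbert-style formulation: Peano arithmetic
(classical first-order logic with equality, and the arithmetical axioms, for all formulas with the
operators `□` and `P`), and the modal, the epistemic, and the modal-epistemic axioms and rules. -/
inductive MEA : MEAFormula → Prop
  -- classical first-order logic with equality
  | imp_k (A B : MEAFormula) : MEA (imp A (imp B A))
  | imp_s (A B C : MEAFormula) :
      MEA (imp (imp A (imp B C)) (imp (imp A B) (imp A C)))
  | and_intro (A B : MEAFormula) : MEA (imp A (imp B (and A B)))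
  | and_left (A B : MEAFormula) : MEA (imp (and A B) A)
  | and_right (A B : MEAFormula) : MEA (imp (and A B) B)
  | or_left (A B : MEAFormula) : MEA (imp A (or A B))
  | or_right (A B : MEAFormula) : MEA (imp B (or A B))
  | or_elim (A B C : MEAFormula) :
      MEA (imp (imp A C) (imp (imp B C) (imp (or A B) C)))
  | dne (A : MEAFormula) : MEA (imp A.neg.neg A)
  | all_inst (A : MEAFormula) (t : Term) : MEA (imp (all A) (A.inst t))
  | ex_inst (A : MEAFormula) (t : Term) : MEA (imp (A.inst t) (ex A))
  | all_imp (A B : MEAFormula) : MEA (imp (all (imp B.shift A)) (imp B (all A)))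
  | ex_imp (A B : MEAFormula) : MEA (imp (all (imp A B.shift)) (imp (ex A) B))
  | eq_refl (t : Term) : MEA (eq t t)
  | eq_sub (A : MEAFormula) (s t : Term) : MEA (imp (eq s t) (imp (A.inst s) (A.inst t)))
  | mp {A B : MEAFormula} : MEA A → MEA (imp A B) → MEA B
  | gen {A : MEAFormula} : MEA A → MEA (all A)
  -- arithmetic
  | arith {A : MEAFormula} : ArithAxiom Modality A → MEA A
  -- modal axioms and rule
  | box_refl (A : MEAFormula) : MEA (imp (box A) A)
  | box_mp (A B : MEAFormula) : MEA (imp (and (box A) (box (imp A B))) (box B))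
  | box_nec {A : MEAFormula} : MEA A → MEA (box A)
  | dia_box (A : MEAFormula) : MEA (imp (dia A) (box (dia A)))
  | dia_opFree (A : MEAFormula) : A.OpFree → MEA (imp (dia A) A)
  | dia_ex (A : MEAFormula) : MEA (imp (dia (ex A)) (ex (dia A)))
  -- epistemic axioms
  | prf_refl (A : MEAFormula) : MEA (imp (prf A) A)
  | prf_prf (A : MEAFormula) : MEA (imp (prf A) (prf (prf A)))
  -- modal-epistemic rule and axiom
  | dia_prf_nec {A : MEAFormula} : MEA A → MEA (dia (prf A))
  | dia_prf_mp (A B : MEAFormula) :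
      MEA (imp (and (dia (prf A)) (dia (prf (imp A B)))) (dia (prf B)))

/-! ### Markov's rules -/

/-- `R(x, y)`, that is, `f(x, y) = 0`; here `x` is the variable `1` and `y` the variable `0`, so
that `∃ y R(x, y)` is `ex (R f)` and `∀ x ∃ y R(x, y)` is `all (ex (R f))`. -/
def R {M : Type} (f : PRFun 2) : Formula M :=
  Formula.eq (Term.app f ![Term.v 1, Term.v 0]) Term.zero

/-- Markov's rule in `HA`, for the predicate `f(x, y) = 0`. -/
def MR (f : PRFun 2) : Prop :=
  HA [] (.all (.neg (.neg (.ex (R f))))) → HA [] (.all (.ex (R f)))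

/-- `⊢ ◇P∀x¬◇P¬∃yR(x,y) ⇒ ⊢ ◇P∀x∃yR(x,y)` in `MEA`. -/
def HMRNt (f : PRFun 2) : Prop :=
  MEA (dia (prf (.all (.neg (dia (prf (.neg (.ex (R f))))))))) →
    MEA (dia (prf (.all (.ex (R f)))))

/-- `⊢ ◇∀x◇P∃yR(x,y) ⇒ ⊢ ◇P∀x∃yR(x,y)` in `MEA`. -/
def HMRW1 (f : PRFun 2) : Prop :=
  MEA (dia (.all (dia (prf (.ex (R f)))))) → MEA (dia (prf (.all (.ex (R f)))))

/-- `⊢ □∀x¬◇P¬∃yR(x,y) ⇒ ⊢ □∀x∃yR(x,y)` in `MEA`. -/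
def HMRW2 (f : PRFun 2) : Prop :=
  MEA (box (.all (.neg (dia (prf (.neg (.ex (R f)))))))) → MEA (box (.all (.ex (R f))))

/-- `⊢ □∀x◇∃yR(x,y) ⇒ ⊢ □∀x∃yR(x,y)` in `MEA`. -/
def HMRW3 (f : PRFun 2) : Prop :=
  MEA (box (.all (dia (.ex (R f))))) → MEA (box (.all (.ex (R f))))

end ModalArith

/-! The Gödel–Gentzen negative translation, extended so as to erase `□` and `P`, maps theorems of
`MEA` to theorems of `HA` (`MEA.negTrans`). Since `◇` abbreviates `¬□¬`, it becomes `¬¬`, and the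
modal and epistemic principles collapse to intuitionistically valid facts about double negation,
given that translated formulas are stable (`HA.negTrans_stable_imp`).

Each premise of the four rules thus becomes, up to repeated double negations, the `HA`-provability
of `∀x¬¬∃yR`. Markov's rule removes the double negation inside `HA`; `HA` embeds in `MEA`
(`HA.toMEA`), and necessitation by `□` or by `◇P` gives the required conclusion. -/

namespace ModalArith

/-! ### Substitution -/

namespace Term

theorem subst_v (t : Term) : FirstOrder.Language.Term.subst t v = t := by
  induction t with
  | var n => rfl
  | func f ts ih => exact congrArg _ (funext ih)

theorem subst_subst (t : Term) (σ τ : ℕ → Term) :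
    FirstOrder.Language.Term.subst (FirstOrder.Language.Term.subst t σ) τ =
      FirstOrder.Language.Term.subst t fun n => FirstOrder.Language.Term.subst (σ n) τ := by
  induction t with
  | var n => rfl
  | func f ts ih => exact congrArg _ (funext ih)

theorem relabel_eq_subst (t : Term) (g : ℕ → ℕ) :
    FirstOrder.Language.Term.relabel g t =
      FirstOrder.Language.Term.subst t fun n => v (g n) := by
  induction t with
  | var n => rfl
  | func f ts ih => exact congrArg _ (funext ih)

end Term

theorem lift_v : lift Term.v = Term.v := by
  funext n; cases n <;> rfl

theorem lift_subst (σ τ : ℕ → Term) :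
    (fun n => FirstOrder.Language.Term.subst (lift σ n) (lift τ)) =
      lift fun n => FirstOrder.Language.Term.subst (σ n) τ := by
  funext n
  cases n with
  | zero => rfl
  | succ n =>
    simp only [lift, Term.relabel_eq_subst, Term.subst_subst]
    congr 1
    funext k
    exact Term.relabel_eq_subst _ _

namespace Formula

variable {M N : Type}

theorem subst_v (A : Formula M) : A.subst Term.v = A := by
  induction A <;> simp_all [subst, Term.subst_v, lift_v]

theorem subst_subst (A : Formula M) (σ τ : ℕ → Term) :
    (A.subst σ).subst τ = A.subst fun n => FirstOrder.Language.Term.subst (σ n) τ := by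
  induction A generalizing σ τ <;> simp_all [subst, Term.subst_subst, lift_subst]

/-- The composed substitution fixes every variable. This is how a quantified formula from a shifted
context is instantiated at the eigenvariable. -/
theorem subst_lift_shift_inst_v (A : Formula M) :
    (A.subst (lift fun n => Term.v (n + 1))).inst (Term.v 0) = A := by
  rw [inst, subst_subst]
  convert A.subst_v using 2
  funext n
  cases n <;> rfl

/-- Renaming of the sentential operators. -/
def map (g : M → N) : Formula M → Formula N
  | bot => bot
  | eq s t => eq s t
  | and A B => and (A.map g) (B.map g)
  | or A B => or (A.map g) (B.map g)
  | imp A B => imp (A.map g) (B.map g)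
  | all A => all (A.map g)
  | ex A => ex (A.map g)
  | op m A => op (g m) (A.map g)

theorem map_subst (g : M → N) (A : Formula M) (σ : ℕ → Term) :
    (A.subst σ).map g = (A.map g).subst σ := by
  induction A generalizing σ <;> simp_all [subst, map]

theorem map_shift (g : M → N) (A : Formula M) : A.shift.map g = (A.map g).shift :=
  map_subst g A _

theorem map_inst (g : M → N) (A : Formula M) (t : Term) :
    (A.inst t).map g = (A.map g).inst t :=
  map_subst g A _

end Formula

theorem ArithAxiom.map {M N : Type} (g : M → N) {A : Formula M} (h : ArithAxiom M A) :
    ArithAxiom N (A.map g) := by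
  cases h with
  | succ_ne_zero t => exact .succ_ne_zero t
  | succ_inj s t => exact .succ_inj s t
  | add_zero t => exact .add_zero t
  | add_succ s t => exact .add_succ s t
  | mul_zero t => exact .mul_zero t
  | mul_succ s t => exact .mul_succ s t
  | proj i ts => exact .proj i ts
  | comp f g ts => exact .comp f g ts
  | prec_zero f g ts => exact .prec_zero f g ts
  | prec_succ f g t ts => exact .prec_succ f g t ts
  | induction A =>
    simp only [Formula.map, Formula.map_inst, Formula.map_subst]
    exact .induction _

open Formula

/-! ### Heyting arithmetic inside modal-epistemic arithmetic -/

namespace MEA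

variable {A B C G : MEAFormula}

theorem imp_weaken (h : MEA A) : MEA (imp G A) := .mp h (.imp_k A G)

theorem imp_mp (h : MEA (imp G A)) (h' : MEA (imp G (imp A B))) : MEA (imp G B) :=
  .mp h (.mp h' (.imp_s G A B))

theorem imp_self (A : MEAFormula) : MEA (imp A A) :=
  imp_mp (.imp_k A A) (.imp_k A (imp A A))

theorem imp_trans (h : MEA (imp A B)) (h' : MEA (imp B C)) : MEA (imp A C) :=
  imp_mp h (imp_weaken h')

theorem imp_and (h : MEA (imp G A)) (h' : MEA (imp G B)) : MEA (imp G (and A B)) :=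
  imp_mp h' (imp_trans h (.and_intro A B))

/-- With contexts coded as conjunctions, this replaces the deduction theorem: it discharges the head
of a context. -/
theorem imp_curry (h : MEA (imp (and A G) B)) : MEA (imp G (imp A B)) := by
  have h₁ : MEA (imp G (imp A (imp G (and A G)))) := imp_weaken (.and_intro A G)
  have h₂ : MEA (imp G (imp (imp A (imp G (and A G))) (imp (imp A G) (imp A (and A G))))) :=
    imp_weaken (.imp_s _ _ _)
  have h₃ : MEA (imp G (imp A (and A G))) := imp_mp (.imp_k G A) (imp_mp h₁ h₂)
  have h₄ : MEA (imp G (imp A (imp (and A G) B))) := imp_weaken (imp_weaken h)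
  exact imp_mp h₃ (imp_trans h₄ (.imp_s _ _ _))

theorem imp_swap (h : MEA (imp A (imp B C))) : MEA (imp B (imp A C)) :=
  imp_curry (imp_mp (.and_right A B) (imp_trans (.and_left A B) h))

theorem bot_imp (A : MEAFormula) : MEA (imp bot A) :=
  imp_trans (.imp_k bot A.neg) (.dne A)

/-- The conjunction of a context. -/
def conj : List MEAFormula → MEAFormula
  | [] => imp bot bot
  | A :: Γ => and A (conj Γ)

theorem conj_map_shift (Γ : List MEAFormula) : conj (Γ.map shift) = (conj Γ).shift := by
  induction Γ with
  | nil => rfl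
  | cons A Γ ih => simp only [List.map_cons, conj, ih]; rfl

theorem conj_imp_of_mem {Γ : List MEAFormula} (h : A ∈ Γ) : MEA (imp (conj Γ) A) := by
  induction Γ with
  | nil => cases h
  | cons B Γ ih =>
    rcases List.mem_cons.1 h with rfl | h
    · exact .and_left _ _
    · exact imp_trans (.and_right _ _) (ih h)

end MEA

open MEA in
theorem HA.toMEA (g : Empty → Modality) {Γ : List HAFormula} {A : HAFormula} (h : HA Γ A) :
    MEA (imp (conj (Γ.map (Formula.map g))) (A.map g)) := by
  have hsh (Γ : List HAFormula) :
      (Γ.map shift).map (Formula.map g) = (Γ.map (Formula.map g)).map shift := by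
    simp [Function.comp_def, map_shift]
  induction h with
  | assumption h => exact conj_imp_of_mem (List.mem_map_of_mem h)
  | andI _ _ ih₁ ih₂ => exact imp_and ih₁ ih₂
  | andE_left _ ih => exact imp_trans ih (.and_left _ _)
  | andE_right _ ih => exact imp_trans ih (.and_right _ _)
  | orI_left _ ih => exact imp_trans ih (.or_left _ _)
  | orI_right _ ih => exact imp_trans ih (.or_right _ _)
  | orE _ _ _ ih ih₁ ih₂ =>
    exact imp_mp ih (imp_mp (imp_curry ih₂) (imp_trans (imp_curry ih₁) (.or_elim _ _ _)))
  | impI _ ih => exact imp_curry ih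
  | impE _ _ ih₁ ih₂ => exact imp_mp ih₁ ih₂
  | botE _ ih => exact imp_trans ih (bot_imp _)
  | allI _ ih =>
    rw [hsh, conj_map_shift] at ih
    exact .mp (.gen ih) (.all_imp _ _)
  | allE t _ ih =>
    rw [map_inst]
    exact imp_trans ih (.all_inst _ t)
  | exI t _ ih =>
    rw [map_inst] at ih
    exact imp_trans ih (.ex_inst _ t)
  | exE _ _ ih₁ ih₂ =>
    rw [List.map_cons, hsh, conj, conj_map_shift, map_shift] at ih₂
    -- `ex_imp` admits no side context, so the context is moved into the conclusion, as `conj Γ ⊃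
    -- B`; `imp_self` then contracts the two copies of it.
    exact imp_mp (imp_self _)
      (imp_trans ih₁ (.mp (.gen (imp_swap (imp_curry ih₂))) (.ex_imp _ (imp _ _))))
  | eq_refl t => exact imp_weaken (.eq_refl t)
  | eq_sub A _ _ ih₁ ih₂ =>
    rw [map_inst] at ih₂ ⊢
    exact imp_mp ih₂ (imp_trans ih₁ (.eq_sub _ _ _))
  | arith h => exact imp_weaken (.arith (h.map g))

/-! ### The negative translation -/

/-- The Gödel–Gentzen negative translation, erasing the sentential operators. -/
def Formula.negTrans {M : Type} : Formula M → HAFormula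
  | bot => bot
  | eq s t => (eq s t).neg.neg
  | and A B => and A.negTrans B.negTrans
  | or A B => (and A.negTrans.neg B.negTrans.neg).neg
  | imp A B => imp A.negTrans B.negTrans
  | all A => all A.negTrans
  | ex A => (all A.negTrans.neg).neg
  | op _ A => A.negTrans

theorem Formula.negTrans_subst {M : Type} (A : Formula M) (σ : ℕ → Term) :
    (A.subst σ).negTrans = A.negTrans.subst σ := by
  induction A generalizing σ <;> simp_all [subst, negTrans, neg]

theorem Formula.negTrans_inst {M : Type} (A : Formula M) (t : Term) :
    (A.inst t).negTrans = A.negTrans.inst t :=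
  negTrans_subst A _

theorem Formula.negTrans_shift {M : Type} (A : Formula M) :
    A.shift.negTrans = A.negTrans.shift :=
  negTrans_subst A _

/-! ### Derived rules of `HA` and stability of translated formulas -/

namespace HA

variable {Γ Δ : List HAFormula} {A B C : HAFormula}

theorem weaken (h : HA Γ A) (hΓ : Γ ⊆ Δ) : HA Δ A := by
  induction h generalizing Δ with
  | assumption h => exact .assumption (hΓ h)
  | andI _ _ ih₁ ih₂ => exact .andI (ih₁ hΓ) (ih₂ hΓ)
  | andE_left _ ih => exact .andE_left (ih hΓ)
  | andE_right _ ih => exact .andE_right (ih hΓ)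
  | orI_left _ ih => exact .orI_left (ih hΓ)
  | orI_right _ ih => exact .orI_right (ih hΓ)
  | orE _ _ _ ih ih₁ ih₂ =>
    exact .orE (ih hΓ) (ih₁ (List.cons_subset_cons _ hΓ)) (ih₂ (List.cons_subset_cons _ hΓ))
  | impI _ ih => exact .impI (ih (List.cons_subset_cons _ hΓ))
  | impE _ _ ih₁ ih₂ => exact .impE (ih₁ hΓ) (ih₂ hΓ)
  | botE _ ih => exact .botE (ih hΓ)
  | allI _ ih => exact .allI (ih (List.map_subset _ hΓ))
  | allE t _ ih => exact .allE t (ih hΓ)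
  | exI t _ ih => exact .exI t (ih hΓ)
  | exE _ _ ih₁ ih₂ =>
    exact .exE (ih₁ hΓ) (ih₂ (List.cons_subset_cons _ (List.map_subset _ hΓ)))
  | eq_refl t => exact .eq_refl t
  | eq_sub A _ _ ih₁ ih₂ => exact .eq_sub A (ih₁ hΓ) (ih₂ hΓ)
  | arith h => exact .arith h

theorem cons (h : HA Γ A) : HA (B :: Γ) A := h.weaken (List.subset_cons_self B Γ)

theorem hyp₀ : HA (A :: Γ) A := .assumption (by simp)

theorem hyp₁ : HA (B :: A :: Γ) A := .assumption (by simp)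

theorem hyp₂ : HA (C :: B :: A :: Γ) A := .assumption (by simp)

theorem negI (h : HA (A :: Γ) bot) : HA Γ A.neg := .impI h

theorem negE (h : HA Γ A.neg) (h' : HA Γ A) : HA Γ bot := .impE h' h

theorem neg_negI (h : HA Γ A) : HA Γ A.neg.neg := negI (negE hyp₀ h.cons)

theorem neg_of_neg_neg_neg (h : HA Γ A.neg.neg.neg) : HA Γ A.neg :=
  negI (negE h.cons (neg_negI hyp₀))

/-- To refute a formula from a doubly negated hypothesis, the hypothesis itself may be used. -/
theorem bot_of_neg_neg (h : HA Γ A.neg.neg) (h' : HA (A :: Γ) bot) : HA Γ bot :=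
  negE h (negI h')

theorem all_shift_elim (h : HA Γ (all A).shift) : HA Γ A := by
  have h' := h.allE (Term.v 0)
  rwa [subst_lift_shift_inst_v] at h'

theorem exI_v (h : HA Γ A) : HA Γ (ex A).shift := by
  refine .exI (Term.v 0) ?_
  rwa [subst_lift_shift_inst_v]

/-- Equations, disjunctions and existentials translate to negations, for which three negations
reduce to one; conjunction, implication and the universal quantifier preserve stability. -/
theorem negTrans_stable_imp {M : Type} (A : Formula M) (Γ : List HAFormula) :
    HA Γ (imp A.negTrans.neg.neg A.negTrans) := by
  induction A generalizing Γ with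
  | bot => exact .impI (negE hyp₀ (.impI hyp₀))
  | eq s t => exact .impI (neg_of_neg_neg_neg hyp₀)
  | and A B ihA ihB =>
    refine .impI (.andI (.impE ?_ (ihA _)) (.impE ?_ (ihB _)))
    · exact negI (bot_of_neg_neg hyp₁ (negE hyp₁ (.andE_left hyp₀)))
    · exact negI (bot_of_neg_neg hyp₁ (negE hyp₁ (.andE_right hyp₀)))
  | or A B _ _ => exact .impI (neg_of_neg_neg_neg hyp₀)
  | imp A B _ ihB =>
    refine .impI (.impI (.impE ?_ (ihB _)))
    exact negI (bot_of_neg_neg hyp₂ (negE hyp₁ (.impE hyp₂ hyp₀)))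
  | all A ih =>
    refine .impI (.allI (.impE ?_ (ih _)))
    refine negI (bot_of_neg_neg (A := (all A.negTrans).shift) hyp₁ ?_)
    exact negE hyp₁ (all_shift_elim hyp₀)
  | ex A _ => exact .impI (neg_of_neg_neg_neg hyp₀)
  | op m A ih => exact ih Γ

theorem negTrans_stable {M : Type} {A : Formula M} (h : HA Γ A.negTrans.neg.neg) :
    HA Γ A.negTrans :=
  .impE h (negTrans_stable_imp A Γ)

/-- Stable formulas may be proved by contradiction. -/
theorem negTrans_by_contra {M : Type} {A : Formula M} (h : HA (A.negTrans.neg :: Γ) bot) :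
    HA Γ A.negTrans :=
  negTrans_stable (negI h)

end HA

/-! ### Soundness of the negative translation -/

open HA in
theorem ArithAxiom.negTrans {M : Type} {A : Formula M} (h : ArithAxiom M A) :
    HA [] A.negTrans := by
  cases h with
  | succ_ne_zero t =>
    exact .impI (bot_of_neg_neg hyp₀ (negE (.arith (.succ_ne_zero t)) hyp₀))
  | succ_inj s t =>
    exact .impI (negI (bot_of_neg_neg hyp₁ (negE hyp₁ (.impE hyp₀ (.arith (.succ_inj s t))))))
  | add_zero t => exact neg_negI (.arith (.add_zero t))
  | add_succ s t => exact neg_negI (.arith (.add_succ s t))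
  | mul_zero t => exact neg_negI (.arith (.mul_zero t))
  | mul_succ s t => exact neg_negI (.arith (.mul_succ s t))
  | proj i ts => exact neg_negI (.arith (.proj i ts))
  | comp f g ts => exact neg_negI (.arith (.comp f g ts))
  | prec_zero f g ts => exact neg_negI (.arith (.prec_zero f g ts))
  | prec_succ f g t ts => exact neg_negI (.arith (.prec_succ f g t ts))
  | induction A =>
    -- The translation commutes with substitution, so the instance becomes induction for the
    -- translated formula.
    simp only [Formula.negTrans, negTrans_inst, negTrans_subst]
    exact .arith (.induction _)

open HA in
theorem MEA.negTrans {A : MEAFormula} (h : MEA A) : HA [] A.negTrans := by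
  induction h with
  | imp_k A B => exact .impI (.impI hyp₁)
  | imp_s A B C => exact .impI (.impI (.impI (.impE (.impE hyp₀ hyp₁) (.impE hyp₀ hyp₂))))
  | and_intro A B => exact .impI (.impI (.andI hyp₁ hyp₀))
  | and_left A B => exact .impI (.andE_left hyp₀)
  | and_right A B => exact .impI (.andE_right hyp₀)
  | or_left A B => exact .impI (negI (negE (.andE_left hyp₀) hyp₁))
  | or_right A B => exact .impI (negI (negE (.andE_right hyp₀) hyp₁))
  | or_elim A B C =>
    refine .impI (.impI (.impI (negTrans_by_contra (negE hyp₁ (.andI ?_ ?_)))))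
    · exact negI (negE hyp₁ (.impE hyp₀ (.assumption (by simp [Formula.negTrans]))))
    · exact negI (negE hyp₁ (.impE hyp₀ (.assumption (by simp [Formula.negTrans]))))
  | dne A => exact negTrans_stable_imp A []
  | all_inst A t =>
    refine .impI ?_
    rw [negTrans_inst]
    exact .allE t hyp₀
  | ex_inst A t =>
    refine .impI (negI ?_)
    rw [negTrans_inst]
    exact negE (.allE t hyp₀) hyp₁
  | all_imp A B =>
    refine .impI (.impI (.allI ?_))
    simp only [List.map_cons, Formula.negTrans, negTrans_shift]
    exact .impE hyp₀ (all_shift_elim hyp₁)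
  | ex_imp A B =>
    refine .impI (.impI (negTrans_by_contra (negE hyp₁ (.allI (negI ?_)))))
    simp only [List.map_cons, Formula.negTrans, negTrans_shift]
    refine negE (A := B.negTrans.shift) hyp₁ (.impE hyp₀ (all_shift_elim ?_))
    exact .assumption (by simp)
  | eq_refl t => exact neg_negI (.eq_refl t)
  | eq_sub A s t =>
    refine .impI (.impI (negTrans_by_contra (bot_of_neg_neg hyp₂ (negE hyp₁ ?_))))
    rw [negTrans_inst, negTrans_inst]
    exact .eq_sub _ hyp₀ (.assumption (by simp))
  | mp _ _ ih₁ ih₂ => exact .impE ih₁ ih₂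
  | gen _ ih => exact .allI ih
  | arith h => exact h.negTrans
  | box_refl A => exact .impI hyp₀
  | box_mp A B => exact .impI (.impE (.andE_left hyp₀) (.andE_right hyp₀))
  | box_nec _ ih => exact ih
  | dia_box A => exact .impI hyp₀
  | dia_opFree A _ => exact negTrans_stable_imp A []
  | dia_ex A =>
    -- Here `¬¬¬∀x¬A` must yield `¬∀x¬¬¬A`: a hypothesis `∀x¬¬¬A` reduces to `∀x¬A`.
    refine .impI (negI (bot_of_neg_neg hyp₁ (negE hyp₀ (.allI ?_))))
    refine neg_of_neg_neg_neg (A := A.negTrans) (all_shift_elim ?_)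
    exact .assumption (by simp [Formula.negTrans, dia, box, neg])
  | prf_refl A => exact .impI hyp₀
  | prf_prf A => exact .impI hyp₀
  | dia_prf_nec _ ih => exact neg_negI ih
  | dia_prf_mp A B =>
    -- The goal is now absurdity, so both double negations may be opened.
    refine .impI (negI (bot_of_neg_neg (.andE_left hyp₁) (bot_of_neg_neg (.andE_right hyp₂) ?_)))
    exact negE hyp₂ (.impE hyp₁ hyp₀)

/-! ### Markov's rules -/

/-- The translation is `¬∀y¬¬¬R`. From `¬∃yR` one gets `¬R`, hence `¬¬¬R`, for every `y`;
decidability of `R` plays no role. -/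
theorem HA.neg_neg_ex_of_negTrans {M : Type} {f : PRFun 2} {Γ : List HAFormula}
    (h : HA Γ (ex (R f : Formula M)).negTrans) : HA Γ (ex (R f)).neg.neg := by
  refine negI (negE h.cons (.allI (neg_negI (negI ?_))))
  exact negE (A := (ex (R f)).shift) hyp₁ (exI_v hyp₀)

/-- Markov's rule gives `∀ x ∃ y R(x, y)` in `MEA` from the provability in `HA` of `∀ x B` for a
formula `B` that implies the negative translation of `∃ y R(x, y)`. -/
theorem MR.mea_all_ex {f : PRFun 2} (hMR : MR f) {B : HAFormula} (h : HA [] (all B))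
    (hB : HA [B, (all B).shift] (ex (R f : MEAFormula)).negTrans) : MEA (all (ex (R f))) := by
  have h₁ : HA [] (imp (all B) (all (ex (R f)).neg.neg)) :=
    .impI (.allI (HA.neg_neg_ex_of_negTrans
      (.impE (HA.all_shift_elim HA.hyp₀) (.impI hB))))
  -- The empty context is coded as `⊥ ⊃ ⊥`, which is discharged here.
  exact .mp (MEA.imp_self bot) ((hMR (.impE h h₁)).toMEA Empty.elim)

/-- With `E` the translation of `∃yR`, the premise becomes `¬¬∀x¬¬¬¬E`. Stability removes the outer
pair; inside, three negations reduce to one, and stability of `E` removes the remaining pair. The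
other three rules differ only in which of these negations occur. -/
theorem MR.hmrNt {f : PRFun 2} (hMR : MR f) : HMRNt f := fun h =>
  .dia_prf_nec (hMR.mea_all_ex (HA.negTrans_stable (A := all _) h.negTrans)
    (HA.negTrans_stable (HA.neg_of_neg_neg_neg HA.hyp₀)))

theorem MR.hmrW1 {f : PRFun 2} (hMR : MR f) : HMRW1 f := fun h =>
  .dia_prf_nec (hMR.mea_all_ex (HA.negTrans_stable (A := all _) h.negTrans)
    (HA.negTrans_stable HA.hyp₀))

theorem MR.hmrW2 {f : PRFun 2} (hMR : MR f) : HMRW2 f := fun h =>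
  .box_nec (hMR.mea_all_ex h.negTrans (HA.negTrans_stable (HA.neg_of_neg_neg_neg HA.hyp₀)))

theorem MR.hmrW3 {f : PRFun 2} (hMR : MR f) : HMRW3 f := fun h =>
  .box_nec (hMR.mea_all_ex h.negTrans (HA.negTrans_stable HA.hyp₀))

end ModalArith

theorem theorem7p3 (f : ModalArith.PRFun 2) (hMR : ModalArith.MR f) :
    ModalArith.HMRNt f ∧ ModalArith.HMRW1 f ∧ ModalArith.HMRW2 f ∧ ModalArith.HMRW3 f :=
  ⟨hMR.hmrNt, hMR.hmrW1, hMR.hmrW2, hMR.hmrW3⟩
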